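/- Let $X$ be a scheme smooth over $\operatorname{Spec}\mathbb{Z}$ (smooth of some relative dimension in a neighbourhood of every point), let $\mathcal{I}\subset\mathcal{O}_X$ be a coherent ideal sheaf and let $m\ge 0$ be an integer. For a prime ideal $(p)\subset\mathbb{Z}$ (possibly zero) let $\mathbb{F}_p$ denote the residue field of $\operatorname{Spec}\mathbb{Z}$ at $(p)$, so $\mathbb{F}_p=\mathbb{Z}/p$ if $p\neq 0$ and $\mathbb{F}_0=\mathbb{Q}$; let $X_p=X\times_{\operatorname{Spec}\mathbb{Z}}\operatorname{Spec}\mathbb{F}_p$ be the fibre and $\pi_p\colon X_p\to X$ the projection. For an ideal sheaf $\mathcal{K}$ on $X$ write $\mathcal{K}_p=\pi_p^{*}\mathcal{K}$ for its pullback as an ideal, i.e. the ideal of $\mathcal{O}_{X_p}$ generated by the image of $\pi_p^{-1}\mathcal{K}$. For a ring homomorphism $B\to A$ let $\Delta$ be the kernel of the multiplication $A\otimes_B A\to A$, let $P^m_{A/B}=(A\otimes_B A)/\Delta^{m+1}$, an $A$-module via the left factor, and let $D^{\le m}_{A/B}=\operatorname{Hom}_A(P^m_{A/B},A)$ be the module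 of differential operators of order at most $m$, where $D$ acts on $A$ by $a\mapsto D([1\otimes a])$. For a morphism $Y\to S$ locally of finite presentation and a quasi-coherent ideal sheaf $\mathcal{J}\subset\mathcal{O}_Y$, let $\mathcal{D}^{\le m}_{Y/S}\mathcal{J}$ be the quasi-coherent ideal sheaf generated by all sections $D s$, where $U\subset Y$ is an affine open lying over an affine open $V\subset S$, $s\in\mathcal{J}(U)$ and $D\in D^{\le m}_{\mathcal{O}(U)/\mathcal{O}(V)}$. Then for every prime ideal $(p)\subset\mathbb{Z}$, as ideal sheaves on $X_p$, $$(\mathcal{D}^{\le m}_{X/\operatorname{Spec}\mathbb{Z}}\,\mathcal{I})_p=\mathcal{D}^{\le m}_{X_p/\operatorname{Spec}\mathbb{F}_p}\,\mathcal{I}_p .$$ -/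

import Mathlib

open CategoryTheory AlgebraicGeometry TensorProduct

universe u v w

noncomputable section

/-- The module of principal parts `P^m_{A/B} = (A ⊗_B A) / Δ^(m+1)`, where `Δ` is the kernel of the
multiplication map `A ⊗_B A → A`. It is regarded as an `A`-module through the left factor. -/
abbrev PrincipalParts (B : Type v) (A : Type w) [CommRing B] [CommRing A] [Algebra B A] (m : ℕ) :
    Type w :=
  (A ⊗[B] A) ⧸ (KaehlerDifferential.ideal B A) ^ (m + 1)

/-- The universal `B`-linear differential operator `A → P^m_{A/B}` of order at most `m`,
`a ↦ [1 ⊗ a]`. -/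
def PrincipalParts.univ (B : Type v) (A : Type w) [CommRing B] [CommRing A] [Algebra B A] (m : ℕ) :
    A →ₗ[B] PrincipalParts B A m :=
  (Ideal.Quotient.mkₐ B ((KaehlerDifferential.ideal B A) ^ (m + 1))).toLinearMap ∘ₗ
    (Algebra.TensorProduct.includeRight : A →ₐ[B] A ⊗[B] A).toLinearMap

/-- The `A`-module `D^{≤ m}_{A/B} = Hom_A(P^m_{A/B}, A)` of differential operators of `A` over `B`
of order at most `m`. -/
abbrev DiffOp (B : Type v) (A : Type w) [CommRing B] [CommRing A] [Algebra B A] (m : ℕ) :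
    Type w :=
  PrincipalParts B A m →ₗ[A] A

/-- The `B`-linear endomorphism `a ↦ D [1 ⊗ a]` of `A` given by a differential operator `D`. -/
def DiffOp.toEnd {B : Type v} {A : Type w} [CommRing B] [CommRing A] [Algebra B A] {m : ℕ}
    (D : DiffOp B A m) : A →ₗ[B] A :=
  D.restrictScalars B ∘ₗ PrincipalParts.univ B A m

/-- The ideal `D^{≤ m}_{A/B} I` of `A` generated by all `D f`, with `D` a differential operator of
`A` over `B` of order at most `m` and `f ∈ I`. -/
def Ideal.diff (B : Type v) {A : Type w} [CommRing B] [CommRing A] [Algebra B A] (m : ℕ)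
    (I : Ideal A) : Ideal A :=
  Ideal.span {a | ∃ D : DiffOp B A m, ∃ f ∈ I, D.toEnd f = a}

/-- `Ideal.diff` for the algebra given by a ring homomorphism. -/
def RingHom.diffIdeal {B : Type v} {A : Type w} [CommRing B] [CommRing A] (φ : B →+* A) (m : ℕ)
    (I : Ideal A) : Ideal A :=
  letI := φ.toAlgebra
  I.diff B m

/-- The ideal sheaf `𝒟^{≤ m}_{X/S} 𝓘` of `X`, for a morphism of schemes `f : X ⟶ S` and a
quasi-coherent ideal sheaf `𝓘` on `X`: the (quasi-coherent) ideal sheaf generated by all sections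
`D s`, where `s` is a section of `𝓘` and `D` is a differential operator of order at most `m`
relative to `S`, over an affine open `U` of `X` lying over an affine open `V` of `S`.
(The differential operators on such a `U` are `D^{≤ m}_{Γ(X, U)/Γ(S, V)}`.) -/
def AlgebraicGeometry.Scheme.Hom.diffIdeal {X S : Scheme.{u}} (f : X ⟶ S) (m : ℕ)
    (I : X.IdealSheafData) : X.IdealSheafData :=
  sInf {J | ∀ (V : S.affineOpens) (U : X.affineOpens) (h : U.1 ≤ f ⁻¹ᵁ V.1),
    (f.appLE V.1 U.1 h).hom.diffIdeal m (I.ideal U) ≤ J.ideal U}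

end

/-! Two inclusions, both read off from principal parts `P`. "⊆" needs no smoothness. An operator `D`
on `A` base changes to a functional on `A' ⊗[A] P`. If the universal operator extends to a ring map
from `A'` to this ring, congruent to the structure map modulo the nilpotent diagonal ideal, the
universal property of principal parts of `A'` turns the functional into an operator extending `D`.
This applies to pushouts and to localizations. With finite presentation of `P`, localization even
gives equality, so over an affine base the sheaf is computed on every affine open (`diffIdeal_eq`).
"⊇" uses smoothness. An operator on `A'` restricts to an `A`-linear functional `E : P → A'`. Locally
`A` is étale over a polynomial ring, so `P` has a finite dual basis `(D i, e i)`
(`exists_dualBasis`). Hence `E [1 ⊗ s] = ∑ D i s • E (e i)` lies in the extension of the ideal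
generated by the `D i s`. -/

noncomputable section

/-! ### Universal property of principal parts. -/

namespace PrincipalParts

variable {B A : Type*} [CommRing B] [CommRing A] [Algebra B A] {m : ℕ}

lemma univ_apply (a : A) : univ B A m a = Ideal.Quotient.mk _ (1 ⊗ₜ a) := rfl

lemma algebraMap_apply (a : A) :
    algebraMap A (PrincipalParts B A m) a = Ideal.Quotient.mk _ (a ⊗ₜ 1) := rfl

variable (B A m) in
/-- The universal differential operator as an algebra homomorphism. -/
def univAlgHom : A →ₐ[B] PrincipalParts B A m :=
  (Ideal.Quotient.mkₐ B ((KaehlerDifferential.ideal B A) ^ (m + 1))).comp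
    Algebra.TensorProduct.includeRight

variable (B A m) in
/-- The image of the ideal of the diagonal in the ring of principal parts. -/
def diagIdeal : Ideal (PrincipalParts B A m) :=
  (KaehlerDifferential.ideal B A).map (Ideal.Quotient.mk _)

lemma diagIdeal_pow : diagIdeal B A m ^ (m + 1) = ⊥ := by
  rw [diagIdeal, ← Ideal.map_pow, Ideal.map_quotient_self]

lemma univ_sub_mem (a : A) :
    univ B A m a - algebraMap A _ a ∈ diagIdeal B A m := by
  rw [univ_apply, algebraMap_apply, ← map_sub]
  exact Ideal.mem_map_of_mem _ (KaehlerDifferential.one_smul_sub_smul_one_mem_ideal B a)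

section lift

variable {C : Type*} [CommRing C] [Algebra A C] [Algebra B C] [IsScalarTower B A C]

/-- The universal property of the ring of principal parts. -/
def lift (σ : A →ₐ[B] C) (J : Ideal C) (hJ : J ^ (m + 1) = ⊥)
    (h : ∀ a, σ a - algebraMap A C a ∈ J) : PrincipalParts B A m →ₐ[A] C :=
  Ideal.Quotient.liftₐ _
    (Algebra.TensorProduct.lift (Algebra.ofId A C) σ fun _ _ ↦ Commute.all _ _) <| by
    intro x hx
    rw [← RingHom.mem_ker]
    refine (?_ : _ ≤ RingHom.ker (Algebra.TensorProduct.lift (Algebra.ofId A C) σ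
      fun _ _ ↦ Commute.all _ _)) hx
    rw [RingHom.ker_eq_comap_bot, ← hJ, ← Ideal.map_le_iff_le_comap, Ideal.map_pow]
    refine Ideal.pow_right_mono ?_ _
    rw [← KaehlerDifferential.span_range_eq_ideal, Ideal.map_span, Ideal.span_le]
    rintro _ ⟨_, ⟨a, rfl⟩, rfl⟩
    simpa [Algebra.ofId_apply] using h a

@[simp]
lemma lift_univ (σ : A →ₐ[B] C) (J : Ideal C) (hJ : J ^ (m + 1) = ⊥)
    (h : ∀ a, σ a - algebraMap A C a ∈ J) (a : A) : lift σ J hJ h (univ B A m a) = σ a := by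
  rw [univ_apply]
  change Algebra.TensorProduct.lift (Algebra.ofId A C) σ (fun _ _ ↦ Commute.all _ _) (1 ⊗ₜ a) = _
  simp

lemma algHom_ext {g₁ g₂ : PrincipalParts B A m →ₐ[A] C}
    (h : ∀ a, g₁ (univ B A m a) = g₂ (univ B A m a)) : g₁ = g₂ := by
  refine Ideal.Quotient.algHom_ext _ ?_
  refine Algebra.TensorProduct.ext ?_ ?_
  · ext
  · ext a
    exact h a

end lift

end PrincipalParts

open PrincipalParts

/-! ### Extending operators along pushouts and localizations. -/

section Extension

variable {B B' : Type*} {A : Type v} {A' : Type w} [CommRing B] [CommRing A] [CommRing B']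
  [CommRing A'] [Algebra B A] [Algebra B' A'] [Algebra A A'] {m : ℕ}

/-- The base change of a differential operator to `A'`, as a functional on `A' ⊗[A] P`. -/
lemma DiffOp.exists_baseChange (D : DiffOp B A m) :
    ∃ (C : Type (max v w)) (_ : CommRing C) (_ : Algebra A' C) (ι : PrincipalParts B A m →+* C)
      (L : C →ₗ[A'] A'),
      (∀ a, ι (algebraMap A _ a) = algebraMap A' C (algebraMap A A' a)) ∧
      ∀ y, L (ι y) = algebraMap A A' (D y) := by
  refine ⟨A' ⊗[A] PrincipalParts B A m, inferInstance, inferInstance,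
    (Algebra.TensorProduct.includeRight :
      PrincipalParts B A m →ₐ[A] A' ⊗[A] PrincipalParts B A m).toRingHom,
    LinearMap.liftBaseChange A' (Algebra.linearMap A A' ∘ₗ D), fun a ↦ ?_, fun y ↦ ?_⟩
  · exact (Algebra.TensorProduct.includeRight :
      PrincipalParts B A m →ₐ[A] A' ⊗[A] PrincipalParts B A m).commutes a
  · exact (LinearMap.liftBaseChange_tmul _ _ _ _).trans (one_smul _ _)

section

variable {C : Type*} [CommRing C] [Algebra A' C] [Algebra B' C] [IsScalarTower B' A' C]
  (ι : PrincipalParts B A m →+* C)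

lemma map_diagIdeal_pow : (diagIdeal B A m).map ι ^ (m + 1) = ⊥ := by
  rw [← Ideal.map_pow, diagIdeal_pow, Ideal.map_bot]

lemma map_univ_sub_mem
    (hι : ∀ a, ι (algebraMap A _ a) = algebraMap A' C (algebraMap A A' a)) (a : A) :
    ι (univ B A m a) - algebraMap A' C (algebraMap A A' a) ∈ (diagIdeal B A m).map ι := by
  rw [← hι, ← map_sub]
  exact Ideal.mem_map_of_mem _ (univ_sub_mem a)

/-- A differential operator on `A` extends to `A'` as soon as the universal operator does. -/
lemma DiffOp.exists_extension (D : DiffOp B A m) (L : C →ₗ[A'] A')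
    (hL : ∀ y, L (ι y) = algebraMap A A' (D y)) (σ : A' →ₐ[B'] C)
    (hσ : ∀ a, σ (algebraMap A A' a) = ι (univ B A m a))
    (hJ : ∀ a', σ a' - algebraMap A' C a' ∈ (diagIdeal B A m).map ι) :
    ∃ D' : DiffOp B' A' m, ∀ a, D'.toEnd (algebraMap A A' a) = algebraMap A A' (D.toEnd a) := by
  let g : PrincipalParts B' A' m →ₐ[A'] C := PrincipalParts.lift σ _ (map_diagIdeal_pow ι) hJ
  refine ⟨{ toFun := fun x ↦ L (g x), map_add' := by simp, map_smul' := fun c x ↦ ?_ }, fun a ↦ ?_⟩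
  · rw [RingHom.id_apply, ← map_smul L, ← map_smul g]
  · change L (g (univ B' A' m (algebraMap A A' a))) = _
    rw [lift_univ, hσ, hL]
    rfl

end

variable [Algebra B B'] [Algebra B A'] [IsScalarTower B A A']

lemma DiffOp.exists_extension_of_isPushout [IsScalarTower B B' A'] [Algebra.IsPushout B A B' A']
    (D : DiffOp B A m) :
    ∃ D' : DiffOp B' A' m, ∀ a, D'.toEnd (algebraMap A A' a) = algebraMap A A' (D.toEnd a) := by
  obtain ⟨C, _, _, ι, L, hι, hL⟩ := D.exists_baseChange (A' := A')
  algebraize_only [(algebraMap A' C).comp (algebraMap B' A')]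
  let : Algebra B C := ((algebraMap B' C).comp (algebraMap B B')).toAlgebra
  have : IsScalarTower B' A' C := .of_algebraMap_eq' rfl
  have : IsScalarTower B B' C := .of_algebraMap_eq' rfl
  let f : A →ₐ[B] C :=
    { ι.comp (univAlgHom B A m).toRingHom with
      commutes' := fun b ↦ by
        change ι (univAlgHom B A m (algebraMap B A b)) = _
        rw [AlgHom.commutes, IsScalarTower.algebraMap_apply B A (PrincipalParts B A m), hι,
          ← IsScalarTower.algebraMap_apply B A A', IsScalarTower.algebraMap_apply B B' A',
          ← IsScalarTower.algebraMap_apply B' A' C, ← IsScalarTower.algebraMap_apply B B' C] }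
  let g : B' →ₐ[B] C := IsScalarTower.toAlgHom B B' C
  let σ := Algebra.pushoutDesc A' f g (fun _ _ ↦ mul_comm _ _)
  have hf (a : A) : σ (algebraMap A A' a) = ι (univ B A m a) :=
    Algebra.pushoutDesc_left _ _ _ _ _
  have hg (b : B') : σ (algebraMap B' A' b) = algebraMap B' C b :=
    Algebra.pushoutDesc_right _ _ _ _ _
  refine DiffOp.exists_extension ι D L hL { σ with commutes' := hg } hf (fun a' ↦ ?_)
  change σ a' - algebraMap A' C a' ∈ _
  -- `A'` is spanned over `B'` by the image of `A`, and `σ` is `B'`-linear, so the congruence need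
  -- only be checked on `A`.
  have H := ‹Algebra.IsPushout B A B' A'›.symm.1
  induction a' using H.inductionOn with
  | zero => simp
  | tmul a =>
    change σ (algebraMap A A' a) - algebraMap A' C (algebraMap A A' a) ∈ _
    rw [hf]
    exact map_univ_sub_mem ι hι a
  | smul b x hx =>
    rw [Algebra.smul_def, map_mul, map_mul, hg, ← IsScalarTower.algebraMap_apply, ← mul_sub]
    exact Ideal.mul_mem_left _ _ hx
  | add x y hx hy =>
    rw [map_add, map_add, add_sub_add_comm]
    exact add_mem hx hy

omit [Algebra B B'] in
lemma DiffOp.exists_extension_of_isLocalization (S : Submonoid A) [IsLocalization S A']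
    (D : DiffOp B A m) :
    ∃ D' : DiffOp B A' m, ∀ a, D'.toEnd (algebraMap A A' a) = algebraMap A A' (D.toEnd a) := by
  obtain ⟨C, _, _, ι, L, hι, hL⟩ := D.exists_baseChange (A' := A')
  let : Algebra B C := ((algebraMap A' C).comp (algebraMap B A')).toAlgebra
  have : IsScalarTower B A' C := .of_algebraMap_eq' rfl
  let f : A →ₐ[B] C :=
    { ι.comp (univAlgHom B A m).toRingHom with
      commutes' := fun b ↦ by
        change ι (univAlgHom B A m (algebraMap B A b)) = _
        rw [AlgHom.commutes, IsScalarTower.algebraMap_apply B A (PrincipalParts B A m), hι,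
          ← IsScalarTower.algebraMap_apply B A A', ← IsScalarTower.algebraMap_apply B A' C] }
  have hfJ (a : A) : f a - algebraMap A' C (algebraMap A A' a) ∈ (diagIdeal B A m).map ι :=
    map_univ_sub_mem ι hι a
  have hS (s : S) : IsUnit (algebraMap A' C (algebraMap A A' s)) :=
    (IsLocalization.map_units A' s).map (algebraMap A' C)
  have hfu (s : S) : IsUnit (f s) := by
    have : IsNilpotent (f s - algebraMap A' C (algebraMap A A' s)) :=
      ⟨m + 1, by
        rw [← Ideal.mem_bot, ← map_diagIdeal_pow ι]; exact Ideal.pow_mem_pow (hfJ s) _⟩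
    -- A unit plus a nilpotent is a unit.
    simpa using this.isUnit_add_left_of_commute (hS s) (Commute.all _ _)
  let σ : A' →ₐ[B] C := IsLocalization.liftAlgHom (M := S) hfu
  have hσ (a : A) : σ (algebraMap A A' a) = f a := by simp [σ]
  refine DiffOp.exists_extension ι D L hL σ hσ (fun a' ↦ ?_)
  obtain ⟨a, s, rfl⟩ := IsLocalization.exists_mk'_eq S a'
  set x := IsLocalization.mk' A' a s
  have hx : x * algebraMap A A' s = algebraMap A A' a := IsLocalization.mk'_spec A' a s
  have h₁ : σ x * f s = f a := by rw [← hσ, ← hσ, ← map_mul, hx]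
  have h₂ : (σ x - algebraMap A' C x) * algebraMap A' C (algebraMap A A' s) =
      (f a - algebraMap A' C (algebraMap A A' a)) -
        σ x * (f s - algebraMap A' C (algebraMap A A' s)) := by
    rw [← hx, ← h₁, map_mul]; ring
  exact (Ideal.mul_unit_mem_iff_mem _ (hS s)).mp
    (h₂ ▸ sub_mem (hfJ a) (Ideal.mul_mem_left _ _ (hfJ s)))

end Extension

/-! ### Restricting operators from `A'` to `A`. -/

section Restriction

variable {B A B' A' : Type*} [CommRing B] [CommRing A] [CommRing B'] [CommRing A']
  [Algebra B A] [Algebra B' A'] [Algebra A A'] [Algebra B B'] [Algebra B A']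
  [IsScalarTower B A A'] [IsScalarTower B B' A'] {m : ℕ}

lemma Ideal.map_diff_le_of_isPushout [Algebra.IsPushout B A B' A'] (I : Ideal A) :
    (I.diff B m).map (algebraMap A A') ≤ (I.map (algebraMap A A')).diff B' m := by
  rw [Ideal.diff, Ideal.map_span, Ideal.span_le]
  rintro _ ⟨_, ⟨D, f, hf, rfl⟩, rfl⟩
  obtain ⟨D', hD'⟩ := D.exists_extension_of_isPushout (B' := B') (A' := A')
  exact Ideal.subset_span ⟨D', _, Ideal.mem_map_of_mem _ hf, hD' f⟩

lemma Ideal.map_diff_le_of_isLocalization (S : Submonoid A) [IsLocalization S A'] (I : Ideal A) :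
    (I.diff B m).map (algebraMap A A') ≤ (I.map (algebraMap A A')).diff B m := by
  rw [Ideal.diff, Ideal.map_span, Ideal.span_le]
  rintro _ ⟨_, ⟨D, f, hf, rfl⟩, rfl⟩
  obtain ⟨D', hD'⟩ := D.exists_extension_of_isLocalization (A' := A') S
  exact Ideal.subset_span ⟨D', _, Ideal.mem_map_of_mem _ hf, hD' f⟩

/-- A differential operator on `A'` restricts to a functional on the principal parts of `A`. -/
lemma DiffOp.exists_restrict (D : DiffOp B' A' m) :
    ∃ E : PrincipalParts B A m →ₗ[A] A', ∀ a, E (univ B A m a) = D.toEnd (algebraMap A A' a) := by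
  let σ : A →ₐ[B] PrincipalParts B' A' m :=
    ((univAlgHom B' A' m).restrictScalars B).comp (IsScalarTower.toAlgHom B A A')
  let κ : PrincipalParts B A m →ₐ[A] PrincipalParts B' A' m :=
    PrincipalParts.lift σ _ diagIdeal_pow fun a ↦ by
      rw [IsScalarTower.algebraMap_apply A A' (PrincipalParts B' A' m)]
      exact univ_sub_mem _
  have hκ (a : A) : κ (univ B A m a) = univ B' A' m (algebraMap A A' a) := lift_univ _ _ _ _ _
  refine ⟨{ toFun := fun y ↦ D (κ y)
            map_add' := fun y z ↦ by rw [map_add, map_add]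
            map_smul' := fun a y ↦ by
              rw [map_smul, ← algebraMap_smul A', map_smul, algebraMap_smul, RingHom.id_apply] },
    fun a ↦ congrArg D (hκ a)⟩

/-- The formation of `Ideal.diff` can only shrink under a change of rings for which functionals on
principal parts take the expected values. -/
lemma Ideal.diff_map_le (I : Ideal A)
    (H : ∀ E : PrincipalParts B A m →ₗ[A] A', ∀ s ∈ I,
      E (univ B A m s) ∈ (I.diff B m).map (algebraMap A A')) :
    (I.map (algebraMap A A')).diff B' m ≤ (I.diff B m).map (algebraMap A A') := by
  rw [Ideal.diff, Ideal.span_le]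
  rintro _ ⟨D', s, hs, rfl⟩
  change D' (univ B' A' m s) ∈ _
  induction hs using Submodule.span_induction generalizing D' with
  | zero => simp
  | add x y _ _ hx hy =>
    rw [map_add, map_add]
    exact add_mem (hx D') (hy D')
  | smul c x _ hx =>
    -- Multiplication by `[1 ⊗ c]` is linear for the left factor, so the coefficient `c` is absorbed
    -- into the operator.
    let D'' : DiffOp B' A' m :=
      { toFun := fun y ↦ D' (univ B' A' m c * y)
        map_add' := fun y z ↦ by rw [mul_add, map_add]
        map_smul' := fun d y ↦ by rw [mul_smul_comm, map_smul, RingHom.id_apply] }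
    convert hx D'' using 1
    change _ = D' (univAlgHom B' A' m c * univAlgHom B' A' m x)
    rw [← map_mul]
    rfl
  | mem x hx =>
    obtain ⟨s, hs, rfl⟩ := hx
    obtain ⟨E, hE⟩ := D'.exists_restrict (B := B) (A := A)
    exact hE s ▸ H E s hs

lemma Ideal.diff_map_le_of_dualBasis {ι : Type*} [Fintype ι] (D : ι → DiffOp B A m)
    (e : ι → PrincipalParts B A m) (he : ∀ x, x = ∑ i, D i x • e i) (I : Ideal A) :
    (I.map (algebraMap A A')).diff B' m ≤ (I.diff B m).map (algebraMap A A') := by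
  refine I.diff_map_le fun E s hs ↦ ?_
  rw [he (univ B A m s), map_sum]
  refine Submodule.sum_mem _ fun i _ ↦ ?_
  rw [map_smul, Algebra.smul_def]
  exact Ideal.mul_mem_right _ _ (Ideal.mem_map_of_mem _ (Ideal.subset_span ⟨D i, s, hs, rfl⟩))

/-- Since `P` is finitely presented, a functional `P → A'` becomes, after multiplication by a
denominator, the image of an operator on `A`. -/
lemma Ideal.diff_map_le_of_isLocalization (S : Submonoid A) [IsLocalization S A']
    [Module.FinitePresentation A (PrincipalParts B A m)] (I : Ideal A) :
    (I.map (algebraMap A A')).diff B m ≤ (I.diff B m).map (algebraMap A A') := by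
  refine I.diff_map_le fun E s hs ↦ ?_
  obtain ⟨D, t, hD⟩ := Module.FinitePresentation.exists_lift_of_isLocalizedModule S
    (Algebra.linearMap A A') E
  have h : algebraMap A A' (D (univ B A m s)) = algebraMap A A' t * E (univ B A m s) :=
    (LinearMap.congr_fun hD _).trans (Algebra.smul_def _ _)
  refine (Ideal.unit_mul_mem_iff_mem _ (IsLocalization.map_units A' t)).mp ?_
  exact h ▸ Ideal.mem_map_of_mem _ (Ideal.subset_span ⟨D, s, hs, rfl⟩)

end Restriction

lemma Ideal.diff_le_of_isScalarTower {B B' A : Type*} [CommRing B] [CommRing B'] [CommRing A]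
    [Algebra B B'] [Algebra B A] [Algebra B' A] [IsScalarTower B B' A] (m : ℕ) (I : Ideal A) :
    I.diff B' m ≤ I.diff B m := by
  refine Ideal.span_mono ?_
  rintro _ ⟨D, f, hf, rfl⟩
  obtain ⟨E, hE⟩ := D.exists_restrict (B := B) (A := A)
  exact ⟨E, f, hf, hE f⟩

/-- Each `[1 ⊗ a] - [a ⊗ 1]` is nilpotent, so `P` is integral over `A`; being a finitely presented
algebra, it is then finite and finitely presented as a module. -/
instance PrincipalParts.instFinitePresentation {B A : Type*} [CommRing B] [CommRing A] [Algebra B A]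
    [Algebra.FinitePresentation B A] (m : ℕ) :
    Module.FinitePresentation A (PrincipalParts B A m) := by
  have : Algebra.FinitePresentation A (PrincipalParts B A m) :=
    .quotient (Ideal.FG.pow (KaehlerDifferential.ideal_fg B A))
  have huniv (a : A) : IsIntegral A (univ B A m a) := by
    have h : IsIntegral A (univ B A m a - algebraMap A _ a) := by
      refine .of_pow m.succ_pos ?_
      have : (univ B A m a - algebraMap A _ a) ^ (m + 1) = 0 := by
        rw [← Ideal.mem_bot, ← diagIdeal_pow]
        exact Ideal.pow_mem_pow (univ_sub_mem a) _
      exact this ▸ isIntegral_zero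
    exact sub_add_cancel (univ B A m a) _ ▸ h.add (isIntegral_algebraMap (x := a))
  have : Algebra.IsIntegral A (PrincipalParts B A m) := by
    refine ⟨fun x ↦ ?_⟩
    obtain ⟨t, rfl⟩ := Ideal.Quotient.mk_surjective x
    induction t with
    | zero => simpa using isIntegral_zero
    | tmul a b =>
      have : Ideal.Quotient.mk (KaehlerDifferential.ideal B A ^ (m + 1)) (a ⊗ₜ b) =
          algebraMap A (PrincipalParts B A m) a * univ B A m b := by
        rw [univ_apply, PrincipalParts.algebraMap_apply, ← map_mul,
          Algebra.TensorProduct.tmul_mul_tmul, one_mul, mul_one]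
      exact this ▸ isIntegral_algebraMap.mul (huniv b)
    | add x y hx hy =>
      rw [map_add]
      exact hx.add hy
  have : Module.Finite A (PrincipalParts B A m) := Algebra.IsIntegral.finite
  exact Module.FinitePresentation.of_finite_of_finitePresentation A (PrincipalParts B A m)

/-! ### Infinitesimal lifting for étale algebras. -/

section Etale

variable {R A C : Type*} [CommRing R] [CommRing A] [CommRing C] [Algebra R A]

/-- Phrased with ring homs because the target will carry two `R`-structures: the one through `A` and
the Taylor shift. -/
lemma Algebra.FormallySmooth.exists_lift_ringHom [Algebra.FormallySmooth R A] (J : Ideal C)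
    (hJ : IsNilpotent J) (g : R →+* C) (k : A →+* C ⧸ J)
    (h : k.comp (algebraMap R A) = (Ideal.Quotient.mk J).comp g) :
    ∃ σ : A →+* C, σ.comp (algebraMap R A) = g ∧ (Ideal.Quotient.mk J).comp σ = k := by
  algebraize_only [g]
  let k' : A →ₐ[R] C ⧸ J := { k with commutes' := RingHom.congr_fun h }
  obtain ⟨σ, hσ⟩ := Algebra.FormallySmooth.exists_lift J hJ k'
  exact ⟨σ, σ.comp_algebraMap, congr(AlgHom.toRingHom $hσ)⟩

lemma Algebra.FormallyUnramified.ringHom_ext [Algebra.FormallyUnramified R A] (J : Ideal C)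
    (hJ : IsNilpotent J) (σ₁ σ₂ : A →+* C)
    (h : σ₁.comp (algebraMap R A) = σ₂.comp (algebraMap R A)) (h' : ∀ a, σ₁ a - σ₂ a ∈ J) :
    σ₁ = σ₂ := by
  algebraize_only [σ₂.comp (algebraMap R A)]
  let τ₁ : A →ₐ[R] C := { σ₁ with commutes' := RingHom.congr_fun h }
  let τ₂ : A →ₐ[R] C := { σ₂ with commutes' := fun _ ↦ rfl }
  have : τ₁ = τ₂ := Algebra.FormallyUnramified.ext J hJ fun a ↦ Ideal.Quotient.eq.mpr (h' a)
  exact congr(AlgHom.toRingHom $this)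

end Etale

/-! ### Taylor expansion in étale coordinates. -/

section Coordinates

open MvPolynomial

variable {B A : Type*} [CommRing B] [CommRing A] [Algebra B A] {n : ℕ}

variable (A n) in
/-- The polynomial ring in `n` variables over `A`, truncated in degrees greater than `m`. -/
abbrev TruncatedPolynomial (m : ℕ) := MvPolynomial (Fin n) A ⧸ idealOfVars (Fin n) A ^ (m + 1)

/-- The coefficient functionals of low degree on a truncated polynomial ring. -/
lemma exists_truncated_coeff (m : ℕ) (α : Fin n →₀ ℕ) (hα : α.degree < m + 1) :
    ∃ c : TruncatedPolynomial A n m →ₗ[A] A, ∀ p, c (Ideal.Quotient.mk _ p) = p.coeff α := by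
  refine ⟨((idealOfVars (Fin n) A ^ (m + 1)).restrictScalars A).liftQ (lcoeff A α) ?_ ∘ₗ
    (Submodule.Quotient.restrictScalarsEquiv A _).symm.toLinearMap, fun p ↦ rfl⟩
  intro p hp
  exact (mem_pow_idealOfVars_iff' _ _).mp hp α hα

lemma truncated_eq_sum (m : ℕ) (s : Finset (Fin n →₀ ℕ)) (hs : ∀ α, α ∈ s ↔ α.degree < m + 1)
    (p : MvPolynomial (Fin n) A) :
    (Ideal.Quotient.mk (idealOfVars (Fin n) A ^ (m + 1)) p) =
      ∑ α ∈ s, p.coeff α • Ideal.Quotient.mkₐ A _ (monomial α 1) := by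
  classical
  simp_rw [← map_smul]
  rw [← map_sum]
  refine Ideal.Quotient.eq.mpr ((mem_pow_idealOfVars_iff' _ _).mpr fun β hβ ↦ ?_)
  simp [coeff_sum, coeff_monomial, (hs β).mpr hβ]

/-- Taylor expansion `ψ` is a section of `θ : X i ↦ [1 ⊗ x i] - [x i ⊗ 1]`, so `P` is a retract of a
truncated polynomial ring; injectivity of `θ` is not needed. -/
lemma PrincipalParts.exists_dualBasis [Algebra (MvPolynomial (Fin n) B) A]
    [IsScalarTower B (MvPolynomial (Fin n) B) A]
    [Algebra.FormallyEtale (MvPolynomial (Fin n) B) A] (m : ℕ) :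
    ∃ (ι : Type) (_ : Fintype ι) (D : ι → DiffOp B A m) (e : ι → PrincipalParts B A m),
      ∀ x, x = ∑ i, D i x • e i := by
  let x (i : Fin n) : A := algebraMap (MvPolynomial (Fin n) B) A (X i)
  let τ (i : Fin n) : PrincipalParts B A m := univ B A m (x i) - algebraMap A _ (x i)
  have hτ : (idealOfVars (Fin n) A).map (aeval τ) ≤ diagIdeal B A m := by
    rw [idealOfVars, Ideal.map_span, Ideal.span_le]
    rintro _ ⟨_, ⟨i, rfl⟩, rfl⟩
    rw [aeval_X]
    exact univ_sub_mem _
  let θ : TruncatedPolynomial A n m →ₐ[A] PrincipalParts B A m :=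
    Ideal.Quotient.liftₐ _ (aeval τ) fun p hp ↦ by
      have := Ideal.pow_right_mono hτ (m + 1)
      rw [diagIdeal_pow, ← Ideal.map_pow] at this
      exact this (Ideal.mem_map_of_mem _ hp)
  have hθ (p) : θ (Ideal.Quotient.mk _ p) = aeval τ p := rfl
  let J : Ideal (TruncatedPolynomial A n m) :=
    (idealOfVars (Fin n) A).map (Ideal.Quotient.mk _)
  have hJ : J ^ (m + 1) = ⊥ := by
    rw [← Ideal.map_pow, Ideal.map_quotient_self]
  have hθJ : J.map θ ≤ diagIdeal B A m := by
    refine le_trans ?_ hτ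
    rw [Ideal.map_le_iff_le_comap, Ideal.map_le_iff_le_comap]
    exact fun p hp ↦ Ideal.mem_map_of_mem (aeval τ) hp
  -- The Taylor shift `x i ↦ x i + X i`; formal smoothness extends it to `A`.
  let g : MvPolynomial (Fin n) B →+* TruncatedPolynomial A n m :=
    eval₂Hom (algebraMap B _) fun i ↦ algebraMap A _ (x i) + Ideal.Quotient.mk _ (X i)
  obtain ⟨σ, hσg, hσk⟩ := Algebra.FormallySmooth.exists_lift_ringHom (A := A) J ⟨_, hJ⟩ g
    ((Ideal.Quotient.mk J).comp (algebraMap A _)) <| by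
      refine MvPolynomial.ringHom_ext (fun b ↦ ?_) fun i ↦ ?_
      · simp only [RingHom.comp_apply, g, eval₂Hom_C]
        rw [← MvPolynomial.algebraMap_eq, ← IsScalarTower.algebraMap_apply,
          ← IsScalarTower.algebraMap_apply]
      · simp only [RingHom.comp_apply, g, eval₂Hom_X', map_add]
        have : Ideal.Quotient.mk J (Ideal.Quotient.mk _ (X i)) = 0 :=
          Ideal.Quotient.eq_zero_iff_mem.mpr <| Ideal.mem_map_of_mem _ <|
            Ideal.subset_span ⟨i, rfl⟩
        rw [this, add_zero]
  let σ' : A →ₐ[B] TruncatedPolynomial A n m :=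
    { σ with
      commutes' := fun b ↦ by
        change σ _ = _
        rw [IsScalarTower.algebraMap_apply B (MvPolynomial (Fin n) B) A]
        refine (RingHom.congr_fun hσg _).trans ?_
        rw [MvPolynomial.algebraMap_eq]
        exact eval₂Hom_C _ _ _ }
  have hσJ (a : A) : σ a - algebraMap A _ a ∈ J := Ideal.Quotient.eq.mp (RingHom.congr_fun hσk a)
  let ψ : PrincipalParts B A m →ₐ[A] TruncatedPolynomial A n m :=
    PrincipalParts.lift σ' J hJ hσJ
  -- Both maps agree on the coordinates and modulo a nilpotent ideal, so formal unramifiedness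
  -- identifies them.
  have hθσ : (θ : _ →+* PrincipalParts B A m).comp σ = univAlgHom B A m := by
    refine Algebra.FormallyUnramified.ringHom_ext (R := MvPolynomial (Fin n) B) (diagIdeal B A m)
      ⟨_, diagIdeal_pow⟩ _ _ ?_ fun a ↦ ?_
    · rw [RingHom.comp_assoc, hσg]
      refine MvPolynomial.ringHom_ext (fun b ↦ ?_) fun i ↦ ?_
      · simp only [RingHom.comp_apply, g, eval₂Hom_C]
        rw [← MvPolynomial.algebraMap_eq, ← IsScalarTower.algebraMap_apply]
        exact ((θ.restrictScalars B).commutes b).trans ((univAlgHom B A m).commutes b).symm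
      · simp only [RingHom.comp_apply, g, eval₂Hom_X', map_add]
        refine (congrArg₂ (· + ·) (θ.commutes _) ((hθ _).trans (aeval_X _ _))).trans ?_
        exact add_sub_cancel _ _
    · have h₁ := hθJ (Ideal.mem_map_of_mem θ (hσJ a))
      have h₂ := sub_mem h₁ (univ_sub_mem (B := B) (m := m) a)
      rw [map_sub, AlgHom.commutes, sub_sub_sub_cancel_right] at h₂
      exact h₂
  have hθψ : θ.comp ψ = AlgHom.id A _ := PrincipalParts.algHom_ext (B := B) fun a ↦
    (congrArg θ (lift_univ σ' J hJ hσJ a)).trans (RingHom.congr_fun hθσ a)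
  have hfin : {α : Fin n →₀ ℕ | α.degree < m + 1}.Finite :=
    (Finsupp.finite_of_degree_le m).subset fun α (hα : α.degree < m + 1) ↦ Nat.lt_succ_iff.mp hα
  choose c hc using exists_truncated_coeff (A := A) (n := n) m
  have hs (α) : α ∈ hfin.toFinset ↔ α.degree < m + 1 := hfin.mem_toFinset
  refine ⟨hfin.toFinset, inferInstance, fun α ↦
    { toFun := fun y ↦ c α ((hs _).mp α.2) (ψ y)
      map_add' := fun y z ↦ by rw [map_add, map_add]
      map_smul' := fun a y ↦ by rw [map_smul, map_smul, RingHom.id_apply] },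
    fun α ↦ θ (Ideal.Quotient.mkₐ A _ (monomial α 1)), fun y ↦ ?_⟩
  obtain ⟨p, hp⟩ := Ideal.Quotient.mk_surjective (ψ y)
  have hcy (α) (hα) : c α hα (ψ y) = p.coeff α := hp ▸ hc α hα p
  calc
    y = θ (ψ y) := (AlgHom.congr_fun hθψ y).symm
    _ = ∑ α : hfin.toFinset, p.coeff α • θ (Ideal.Quotient.mkₐ A _ (monomial α 1)) := by
      rw [← hp, truncated_eq_sum m _ hs p, map_sum, ← Finset.sum_coe_sort]
      exact Finset.sum_congr rfl fun α _ ↦ map_smul θ _ _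
    _ = _ := Finset.sum_congr rfl fun α _ ↦ congrArg (· • _) (hcy α _).symm

end Coordinates

/-! ### Transfer to ring homomorphisms. -/

section RingHom

variable {B A B' A' : Type*} [CommRing B] [CommRing A] [CommRing B'] [CommRing A']
  (φ : B →+* A) (φ' : B' →+* A') (β : B →+* B') (ψ : A →+* A') (m : ℕ) (I : Ideal A)

lemma RingHom.diffIdeal_map_eq_of_isLocalization (hφ : φ.FinitePresentation) (S : Submonoid A)
    (hS : @IsLocalization _ _ S A' _ ψ.toAlgebra) :
    (φ.diffIdeal m I).map ψ = (ψ.comp φ).diffIdeal m (I.map ψ) := by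
  algebraize [φ, ψ, ψ.comp φ]
  exact le_antisymm (Ideal.map_diff_le_of_isLocalization S I)
    (Ideal.diff_map_le_of_isLocalization S I)

lemma RingHom.diffIdeal_mono {I J : Ideal A} (h : I ≤ J) :
    φ.diffIdeal m I ≤ φ.diffIdeal m J := by
  algebraize [φ]
  exact Ideal.span_mono fun _ ⟨D, f, hf, hD⟩ ↦ ⟨D, f, h hf, hD⟩

lemma RingHom.diffIdeal_le_diffIdeal_comp (K : Ideal A') :
    ψ.diffIdeal m K ≤ (ψ.comp φ).diffIdeal m K := by
  algebraize [φ, ψ, ψ.comp φ]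
  exact Ideal.diff_le_of_isScalarTower m K

lemma RingHom.diffIdeal_map_le_of_isStandardSmooth (h : ψ.comp φ = φ'.comp β)
    (hφ : φ.IsStandardSmooth) :
    φ'.diffIdeal m (I.map ψ) ≤ (φ.diffIdeal m I).map ψ := by
  obtain ⟨n, g, hg, hge⟩ := hφ.exists_etale_mvPolynomial
  algebraize [φ, ψ, φ', β, ψ.comp φ, g]
  have : IsScalarTower B B' A' := .of_algebraMap_eq' h
  have : IsScalarTower B (MvPolynomial (Fin n) B) A := .of_algebraMap_eq' hg.symm
  obtain ⟨ι, _, D, e, he⟩ := PrincipalParts.exists_dualBasis (B := B) (A := A) (n := n) m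
  exact Ideal.diff_map_le_of_dualBasis D e he I

end RingHom

lemma CommRingCat.map_diffIdeal_le_of_isPushout {B A B' A' : CommRingCat.{u}} {φ : B ⟶ A}
    {β : B ⟶ B'} {ψ : A ⟶ A'} {φ' : B' ⟶ A'} (h : IsPushout φ β ψ φ') (m : ℕ) (I : Ideal A) :
    (φ.hom.diffIdeal m I).map ψ.hom ≤ φ'.hom.diffIdeal m (I.map ψ.hom) := by
  algebraize [φ.hom, ψ.hom, φ'.hom, β.hom, ψ.hom.comp φ.hom]
  have : IsScalarTower B B' A' := .of_algebraMap_eq' congr(CommRingCat.Hom.hom $h.w)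
  have : Algebra.IsPushout B A B' A' := (CommRingCat.isPushout_iff_isPushout ..).mp h
  exact Ideal.map_diff_le_of_isPushout I

/-! ### Pullback of ideal sheaves on affine opens, and globalization. -/

namespace AlgebraicGeometry

variable {X Y S : Scheme.{u}}

lemma Scheme.IdealSheafData.ideal_comap_le_of_isAffine [IsAffine X] [IsAffine Y]
    (I : Y.IdealSheafData) (g : X ⟶ Y) :
    (I.comap g).ideal ⟨⊤, isAffineOpen_top X⟩ ≤
      (I.ideal ⟨⊤, isAffineOpen_top Y⟩).map g.appTop.hom := by
  let K : X.IdealSheafData := .ofIdealTop ((I.ideal ⟨⊤, isAffineOpen_top Y⟩).map g.appTop.hom)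
  have hK : K.ideal ⟨⊤, isAffineOpen_top X⟩ =
      (I.ideal ⟨⊤, isAffineOpen_top Y⟩).map g.appTop.hom :=
    IdealSheafData.equivOfIsAffine.apply_symm_apply
      ((I.ideal ⟨⊤, isAffineOpen_top Y⟩).map g.appTop.hom)
  have : I.comap g ≤ K := by
    rw [← IdealSheafData.le_map_iff_comap_le]
    refine IdealSheafData.le_of_isAffine ?_
    rw [IdealSheafData.ideal_map_of_isAffineHom, ← Ideal.map_le_iff_le_comap]
    exact hK.ge
  exact (this _).trans hK.le

lemma Scheme.IdealSheafData.ideal_comap_ι (I : X.IdealSheafData) (U : X.affineOpens)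
    (hU : IsAffineOpen (⊤ : U.1.toScheme.Opens)) :
    (I.comap U.1.ι).ideal ⟨⊤, hU⟩ = (I.ideal U).map U.1.topIso.inv.hom := by
  rw [ideal_comap_of_isOpenImmersion, Scheme.Opens.ι_appIso]
  exact (I.map_ideal' (U := ⟨U.1.ι ''ᵁ ⊤, hU.image_of_isOpenImmersion U.1.ι⟩) (V := U)
    (eqToHom (by simp)).op).symm

lemma Scheme.IdealSheafData.ideal_comap_le (I : Y.IdealSheafData) (g : X ⟶ Y)
    (U : Y.affineOpens) (W : X.affineOpens) (h : W.1 ≤ g ⁻¹ᵁ U.1) :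
    (I.comap g).ideal W ≤ (I.ideal U).map (g.appLE U.1 W.1 h).hom := by
  have : IsAffine U.1 := U.2
  have : IsAffine W.1 := W.2
  have h₁ := (I.comap U.1.ι).ideal_comap_le_of_isAffine (g.resLE U.1 W.1 h)
  rw [← IdealSheafData.comap_comp, Scheme.Hom.resLE_comp_ι, IdealSheafData.comap_comp,
    ideal_comap_ι, ideal_comap_ι, Scheme.Hom.appTop, Scheme.Hom.resLE_app_top, Ideal.map_map,
    ← CommRingCat.hom_comp, Iso.inv_hom_id_assoc] at h₁
  have h₂ := Ideal.map_mono (f := W.1.topIso.hom.hom) h₁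
  rwa [Ideal.map_map, Ideal.map_map, ← CommRingCat.hom_comp, ← CommRingCat.hom_comp,
    Category.assoc, Iso.inv_hom_id, Category.comp_id, CommRingCat.hom_id, Ideal.map_id] at h₂

lemma Scheme.IdealSheafData.map_le_ideal_comap (I : Y.IdealSheafData) (g : X ⟶ Y) [IsAffineHom g]
    (U : Y.affineOpens) (W : X.affineOpens) (h : W.1 ≤ g ⁻¹ᵁ U.1) :
    (I.ideal U).map (g.appLE U.1 W.1 h).hom ≤ (I.comap g).ideal W := by
  have h₁ := I.le_map_comap g U
  rw [IdealSheafData.ideal_map_of_isAffineHom, ← Ideal.map_le_iff_le_comap] at h₁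
  have h₂ := (I.comap g).map_ideal (U := W) (V := ⟨_, U.2.preimage g⟩) h
  rw [← h₂]
  refine le_trans ?_ (Ideal.map_mono h₁)
  rw [Ideal.map_map]
  rfl

lemma Scheme.Hom.le_preimage_top (f : X ⟶ Y) (U : X.Opens) : U ≤ f ⁻¹ᵁ ⊤ := le_top

section

variable [IsAffine S] (f : X ⟶ S) (m : ℕ) (I : X.IdealSheafData)

/-- The ideal sheaf of derivatives over an affine base, described on every affine open. -/
def Scheme.Hom.diffIdealOfIsAffine [LocallyOfFinitePresentation f] : X.IdealSheafData where
  ideal U := (f.appLE ⊤ U.1 (f.le_preimage_top U.1)).hom.diffIdeal m (I.ideal U)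
  map_ideal_basicOpen U r := by
    have := RingHom.diffIdeal_map_eq_of_isLocalization (f.appLE ⊤ U.1 (f.le_preimage_top U.1)).hom
      (X.presheaf.map (homOfLE <| X.basicOpen_le r).op).hom m (I.ideal U)
      (f.finitePresentation_appLE (isAffineOpen_top S) U.2 _) (.powers r)
      (U.2.isLocalization_basicOpen r)
    rw [this, I.map_ideal_basicOpen, ← CommRingCat.hom_comp, Scheme.Hom.appLE_map]
    rfl

lemma Scheme.Hom.diffIdeal_appLE_le_diffIdealOfIsAffine [LocallyOfFinitePresentation f]
    (V : S.affineOpens) (U : X.affineOpens) (h : U.1 ≤ f ⁻¹ᵁ V.1) :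
    (f.appLE V.1 U.1 h).hom.diffIdeal m (I.ideal U) ≤ (f.diffIdealOfIsAffine m I).ideal U := by
  have := RingHom.diffIdeal_le_diffIdeal_comp (S.presheaf.map (homOfLE le_top).op).hom
    (f.appLE V.1 U.1 h).hom m (I.ideal U)
  rwa [← CommRingCat.hom_comp, Scheme.Hom.map_appLE] at this

lemma Scheme.Hom.diffIdeal_eq [LocallyOfFinitePresentation f] :
    f.diffIdeal m I = f.diffIdealOfIsAffine m I :=
  le_antisymm (sInf_le (f.diffIdeal_appLE_le_diffIdealOfIsAffine m I)) (le_sInf fun _ hJ U ↦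
    hJ ⟨⊤, isAffineOpen_top S⟩ U (f.le_preimage_top U.1))

end

section

variable {X' S' : Scheme.{u}} [IsAffine S] [IsAffine S'] {f : X ⟶ S} {f' : X' ⟶ S'} {g : X' ⟶ X}
  {h : S' ⟶ S} (H : IsPullback g f' f h) (m : ℕ) (I : X.IdealSheafData)

include H in
lemma Scheme.Hom.comap_diffIdeal_le [LocallyOfFinitePresentation f] :
    (f.diffIdeal m I).comap g ≤ f'.diffIdeal m (I.comap g) := by
  have : LocallyOfFinitePresentation f' := MorphismProperty.of_isPullback H ‹_›
  have : IsAffineHom g := MorphismProperty.of_isPullback H.flip inferInstance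
  rw [← Scheme.IdealSheafData.le_map_iff_comap_le, diffIdeal_eq, diffIdeal_eq]
  intro U
  rw [IdealSheafData.ideal_map_of_isAffineHom, ← Ideal.map_le_iff_le_comap]
  have hp := (isIso_pushoutSection_iff H (US := ⊤) (UT := ⊤) (UX := U.1) (UY := g ⁻¹ᵁ U.1)
    (h.le_preimage_top ⊤) (f.le_preimage_top U.1) (by simp)).mp (isIso_pushoutSection_of_isAffineOpen _ _ _ _ (isAffineOpen_top S)
      (isAffineOpen_top S') U.2)
  have h₁ := CommRingCat.map_diffIdeal_le_of_isPushout hp m (I.ideal U)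
  have h₂ := I.map_le_ideal_comap g U ⟨g ⁻¹ᵁ U.1, U.2.preimage g⟩ le_rfl
  rw [g.app_eq_appLE]
  exact h₁.trans (RingHom.diffIdeal_mono _ _ h₂)

include H in
lemma Scheme.Hom.diffIdeal_comap_le [Smooth f] [Subsingleton S'] :
    f'.diffIdeal m (I.comap g) ≤ (f.diffIdeal m I).comap g := by
  have : Smooth f' := MorphismProperty.of_isPullback H ‹_›
  have : IsAffineHom g := MorphismProperty.of_isPullback H.flip inferInstance
  have key (x : X') : ∃ W : X'.affineOpens, x ∈ W.1 ∧
      (f'.diffIdeal m (I.comap g)).ideal W ≤ ((f.diffIdeal m I).comap g).ideal W := by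
    obtain ⟨V, hV, U, hU, hxU, e, he⟩ := Smooth.exists_isStandardSmooth f (g x)
    obtain ⟨_, ⟨W, hW, rfl⟩, hxW, hWU⟩ :=
      X'.isBasis_affineOpens.exists_subset_of_mem_open hxU (g ⁻¹ᵁ U).isOpen
    replace hWU : W ≤ g ⁻¹ᵁ U := hWU
    refine ⟨⟨W, hW⟩, hxW, ?_⟩
    -- As `S'` has a single point, it maps entirely into any open `V` containing the image of `x`.
    have hV' : ⊤ ≤ h ⁻¹ᵁ V := fun y _ ↦ by
      rw [Subsingleton.elim y (f' x)]
      change h (f' x) ∈ V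
      rw [← Scheme.Hom.comp_apply, ← H.w, Scheme.Hom.comp_apply]
      exact e hxU
    rw [f'.diffIdeal_eq, f.diffIdeal_eq]
    calc
      (f'.appLE ⊤ W (f'.le_preimage_top W)).hom.diffIdeal m ((I.comap g).ideal ⟨W, hW⟩)
      _ ≤ (f'.appLE ⊤ W (f'.le_preimage_top W)).hom.diffIdeal m ((I.ideal ⟨U, hU⟩).map (g.appLE U W hWU).hom) :=
        RingHom.diffIdeal_mono _ _ (I.ideal_comap_le g ⟨U, hU⟩ ⟨W, hW⟩ hWU)
      _ ≤ ((f.appLE V U e).hom.diffIdeal m (I.ideal ⟨U, hU⟩)).map (g.appLE U W hWU).hom :=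
        RingHom.diffIdeal_map_le_of_isStandardSmooth _ _ (h.appLE V ⊤ hV').hom _ _ _
          (by rw [← CommRingCat.hom_comp, ← CommRingCat.hom_comp, Scheme.Hom.appLE_comp_appLE,
            Scheme.Hom.appLE_comp_appLE]; simp only [H.w]) he
      _ ≤ ((f.diffIdealOfIsAffine m I).ideal ⟨U, hU⟩).map (g.appLE U W hWU).hom :=
        Ideal.map_mono (f.diffIdeal_appLE_le_diffIdealOfIsAffine m I ⟨V, hV⟩ ⟨U, hU⟩ e)
      _ ≤ _ := IdealSheafData.map_le_ideal_comap _ _ ⟨U, hU⟩ ⟨W, hW⟩ hWU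
  choose W hxW hW using key
  exact IdealSheafData.le_of_iSup_eq_top W
    (top_le_iff.mp fun x _ ↦ TopologicalSpace.Opens.mem_iSup.mpr ⟨x, hxW x⟩) hW

end

end AlgebraicGeometry

end

theorem mainTheorem8 {X : Scheme.{u}} (f : X ⟶ Spec (.of (ULift.{u} ℤ))) [Smooth f]
    (I : X.IdealSheafData) (m : ℕ) (p : Spec (.of (ULift.{u} ℤ))) :
    (f.diffIdeal m I).comap (f.fiberι p) =
      (f.fiberToSpecResidueField p).diffIdeal m (I.comap (f.fiberι p)) := by
  have H : IsPullback (f.fiberι p) (f.fiberToSpecResidueField p) f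
      ((Spec (.of (ULift.{u} ℤ))).fromSpecResidueField p) := IsPullback.of_hasPullback _ _
  have : Subsingleton (Spec ((Spec (.of (ULift.{u} ℤ))).residueField p)) :=
    inferInstanceAs (Subsingleton (PrimeSpectrum _))
  exact le_antisymm (Scheme.Hom.comap_diffIdeal_le H m I) (Scheme.Hom.diffIdeal_comap_le H m I)
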